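/- Let $G$ be a compact Hausdorff abelian group with more than one element and let $H$ be an infinite dimensional complex Hilbert space. Let $\widetilde{\mathcal K(H)}\subset B(H)$ be the C*-subalgebra generated by the compact operators $\mathcal K(H)$ and the identity $I$, let $A=C(G)\otimes\widetilde{\mathcal K(H)}$ (C*-tensor product; equivalently $A=C(G,\widetilde{\mathcal K(H)})$ with $(f\otimes T)(g)=f(g)T$), and let $G$ act on $A$ by $\delta_g=\tau_g\otimes\iota$, where $(\tau_g f)(h)=f(g^{-1}h)$ and $\iota$ is the identity automorphism. For a subgroup $K\subset G$ put $A^{K}=\{a\in A: \delta_g(a)=a \text{ for all } g\in K\}$, for a C*-subalgebra $B\subset A$ put $G^B=\{g\in G:\delta_g(b)=b\text{ for all }b\in B\}$, and let $\mathrm{Aut}_\delta(A)$ be the group of $*$-automorphisms of $A$ commuting with all $\delta_g$, $g\in G$. A subgroup $\mathcal S$ of the $*$-automorphism group $\mathrm{Aut}(A)$ is called - topologically transitive if for any two nonzero $\mathcal S$-invariant hereditary C*-subalgebras $C_1,C_2$ of $A$ there are $c_1\in C_1$, $c_2\in C_2$ with $c_1c_2\neq 0$; - strongly topologically transitive if for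 all finite sequences $x_1,\dots,x_n,y_1,\dots,y_n\in A$ with $\sum_i x_i\otimes y_i\neq0$ in the algebraic tensor product of $A$ with itself over $\mathbb C$ there is $s\in\mathcal S$ with $\sum_i x_i\,s(y_i)\neq 0$. Then $g\mapsto\delta_g(a)$ is norm continuous for every $a\in A$, the fixed point algebra is $A^G=1_{C(G)}\otimes\widetilde{\mathcal K(H)}$, and: (i) there is a subgroup $\mathcal S\subset\mathrm{Aut}_\delta(A)$ which acts strongly topologically transitively, and also topologically transitively, on $A$; (ii) for this $\mathcal S$ there is a C*-subalgebra $B$ of $A$, globally invariant under $G$ and under $\mathcal S$, with $A^G\subset B\subset A$ and $B\neq A^{G^B}$. Thus (strong) topological transitivity of a group $\mathcal S\subset\mathrm{Aut}_\delta(A)$ does not imply that $B=A^{G^B}$ for every $G$- and $\mathcal S$-invariant C*-subalgebra $B$ with $A^G\subset B\subset A$. -/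

import Mathlib

open scoped TensorProduct

noncomputable section

namespace CStarDynamics

/-! ### Groups of automorphisms of a C*-algebra -/

section Automorphisms

variable {A : Type*} [NonUnitalCStarAlgebra A]

/-- The set `B` is globally invariant under the group `S` of `*`-automorphisms. -/
def IsInvariant (S : Subgroup (A ≃⋆ₐ[ℂ] A)) (B : Set A) : Prop :=
  ∀ s ∈ S, s '' B = B

/-- A C*-subalgebra `C` of `A` (a norm closed `*`-subalgebra, not necessarily unital) which is
hereditary: `0 ≤ a ≤ c` and `c ∈ C` imply `a ∈ C`. Positivity of an element of a C*-algebra is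
expressed by its being of the form `x* x`. -/
def IsHereditaryCStarSubalgebra (C : NonUnitalStarSubalgebra ℂ A) : Prop :=
  IsClosed (C : Set A) ∧
    ∀ a c : A, c ∈ C → (∃ x, a = star x * x) → (∃ y, c - a = star y * y) → a ∈ C

/-- Topological transitivity: any two nonzero `S`-invariant hereditary C*-subalgebras have a
nonzero product. -/
def IsTopologicallyTransitive (S : Subgroup (A ≃⋆ₐ[ℂ] A)) : Prop :=
  ∀ C₁ C₂ : NonUnitalStarSubalgebra ℂ A,
    IsHereditaryCStarSubalgebra C₁ → IsInvariant S (C₁ : Set A) → C₁ ≠ ⊥ →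
    IsHereditaryCStarSubalgebra C₂ → IsInvariant S (C₂ : Set A) → C₂ ≠ ⊥ →
    ∃ c₁ ∈ C₁, ∃ c₂ ∈ C₂, c₁ * c₂ ≠ 0

/-- Strong topological transitivity: whenever `∑ xᵢ ⊗ yᵢ ≠ 0` in the algebraic tensor product
`A ⊗ A`, there is `s ∈ S` with `∑ xᵢ s(yᵢ) ≠ 0`. -/
def IsStronglyTopologicallyTransitive (S : Subgroup (A ≃⋆ₐ[ℂ] A)) : Prop :=
  ∀ (n : ℕ) (x y : Fin n → A), (∑ i, x i ⊗ₜ[ℂ] y i : A ⊗[ℂ] A) ≠ 0 →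
    ∃ s ∈ S, ∑ i, x i * s (y i) ≠ 0

end Automorphisms

/-! ### Group actions on a C*-algebra -/

section Actions

variable {G A : Type*} [Group G] [NonUnitalCStarAlgebra A]

/-- `Aut_δ(A)`: the automorphisms of `A` commuting with all `δ_g`. -/
def commutingAut (δ : G →* (A ≃⋆ₐ[ℂ] A)) : Subgroup (A ≃⋆ₐ[ℂ] A) :=
  Subgroup.centralizer (Set.range δ)

/-- `A^K`: the fixed point algebra of the subgroup `K` of `G`. -/
def fixedPoints (δ : G →* (A ≃⋆ₐ[ℂ] A)) (K : Subgroup G) : NonUnitalStarSubalgebra ℂ A where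
  carrier := {a | ∀ g ∈ K, δ g a = a}
  add_mem' ha hb g hg := by rw [map_add, ha g hg, hb g hg]
  zero_mem' g _ := map_zero _
  mul_mem' ha hb g hg := by rw [map_mul, ha g hg, hb g hg]
  smul_mem' c a ha g hg := by rw [map_smul, ha g hg]
  star_mem' ha g hg := by rw [map_star, ha g hg]

/-- `G^B = {g ∈ G | δ_g(b) = b for all b ∈ B}`. -/
def fixingSubgroup (δ : G →* (A ≃⋆ₐ[ℂ] A)) (B : NonUnitalStarSubalgebra ℂ A) : Subgroup G where
  carrier := {g | ∀ b ∈ B, δ g b = b}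
  one_mem' b _ := by simp
  mul_mem' {g h} hg hh b hb := by
    rw [map_mul, StarAlgEquiv.mul_apply, hh b hb, hg b hb]
  inv_mem' {g} hg b hb := by
    rw [map_inv, StarAlgEquiv.aut_inv, StarAlgEquiv.symm_apply_eq, hg b hb]

end Actions

/-! ### The algebra of compact operators with a unit adjoined -/

section Compacts

variable (H : Type*) [NormedAddCommGroup H] [InnerProductSpace ℂ H] [CompleteSpace H]

/-- The C*-subalgebra of `B(H)` generated by the compact operators and the identity operator
(`StarAlgebra.adjoin` always contains the identity). -/
def unitizedCompacts : StarSubalgebra ℂ (H →L[ℂ] H) :=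
  (StarAlgebra.adjoin ℂ {T : H →L[ℂ] H | IsCompactOperator T}).topologicalClosure

instance : CStarAlgebra (unitizedCompacts H) :=
  haveI : IsClosed (unitizedCompacts H : Set (H →L[ℂ] H)) :=
    StarSubalgebra.isClosed_topologicalClosure _
  inferInstance

end Compacts

/-! ### The C*-tensor product `C(G) ⊗ D`

For a compact Hausdorff space `G` and a C*-algebra `D`, the C*-tensor product `C(G) ⊗ D` is realized
as the C*-algebra `C(G, D)`, the elementary tensor `f ⊗ d` being the function `g ↦ f(g) d`. The
facts below show that `C(G, D)` is a C*-completion of the algebraic tensor product. -/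

section Tensor

variable {G D : Type*} [TopologicalSpace G] [CStarAlgebra D]

/-- The elementary tensor `f ⊗ d`. -/
def tensor (f : C(G, ℂ)) (d : D) : C(G, D) where
  toFun g := f g • d
  continuous_toFun := by fun_prop

@[simp] theorem tensor_apply (f : C(G, ℂ)) (d : D) (g : G) : tensor f d g = f g • d := rfl

theorem tensor_mul_tensor (f f' : C(G, ℂ)) (d d' : D) :
    tensor f d * tensor f' d' = tensor (f * f') (d * d') := by
  ext g; exact smul_mul_smul_comm _ _ _ _

theorem star_tensor (f : C(G, ℂ)) (d : D) : star (tensor f d) = tensor (star f) (star d) := by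
  ext g; simp

/-- The canonical map from the algebraic tensor product. -/
def tensorMap : C(G, ℂ) ⊗[ℂ] D →ₗ[ℂ] C(G, D) :=
  TensorProduct.lift (LinearMap.mk₂ ℂ tensor
    (fun _ _ _ => by ext; simp [add_smul]) (fun _ _ _ => by ext; simp [mul_smul])
    (fun _ _ _ => by ext; simp) (fun c f d => by ext g; exact smul_comm (f g) c d))

theorem tensorMap_injective : Function.Injective (tensorMap : C(G, ℂ) ⊗[ℂ] D →ₗ[ℂ] C(G, D)) := by
  refine (injective_iff_map_eq_zero _).2 fun t ht => ?_
  classical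
  let b := Module.Basis.ofVectorSpace ℂ D
  let e := TensorProduct.equivFinsuppOfBasisRight (M := C(G, ℂ)) b
  obtain ⟨c, rfl⟩ := e.symm.surjective t
  suffices c = 0 by simp [this]
  have h1 : e.symm c = c.sum fun i f => f ⊗ₜ[ℂ] b i := by
    simp [e, TensorProduct.equivFinsuppOfBasisRight_symm_apply]
  ext i g
  have h2 : ∀ g : G, c.sum (fun i f => f g • b i) = 0 := by
    intro g
    have := congrArg (fun F : C(G, D) => F g) ht
    simpa [h1, Finsupp.sum, map_sum, ContinuousMap.sum_apply, tensorMap] using this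
  have h3 := linearIndependent_iff'.1 b.linearIndependent c.support (fun i => c i g) (h2 g)
  by_cases hi : i ∈ c.support
  · exact h3 i hi
  · simp [Finsupp.notMem_support_iff.1 hi]

theorem dense_range_tensorMap [CompactSpace G] [T2Space G] :
    DenseRange (tensorMap : C(G, ℂ) ⊗[ℂ] D →ₗ[ℂ] C(G, D)) := by
  intro F
  rw [Metric.mem_closure_range_iff]
  intro ε hε
  obtain ⟨t, ht⟩ := isCompact_univ.elim_finite_subcover
    (fun p : G => F ⁻¹' Metric.ball (F p) (ε / 2))
    (fun p => Metric.isOpen_ball.preimage F.continuous)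
    (fun p _ => Set.mem_iUnion.2 ⟨p, by simp [hε]⟩)
  obtain ⟨ρ, hρ⟩ := PartitionOfUnity.exists_isSubordinate (s := (Set.univ : Set G)) isClosed_univ
    (fun p : t => F ⁻¹' Metric.ball (F p) (ε / 2))
    (fun p => Metric.isOpen_ball.preimage F.continuous)
    (fun x hx => by
      obtain ⟨p, hp, hx⟩ := Set.mem_iUnion₂.1 (ht hx)
      exact Set.mem_iUnion.2 ⟨⟨p, hp⟩, hx⟩)
  refine ⟨∑ p : t, (⟨fun g => (ρ p g : ℂ), by fun_prop⟩ : C(G, ℂ)) ⊗ₜ[ℂ] F p, ?_⟩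
  refine lt_of_le_of_lt ((ContinuousMap.dist_le (half_pos hε).le).2 fun g => ?_) (half_lt_self hε)
  have hs : ∑ p : t, ρ p g = 1 := by
    rw [← finsum_eq_sum_of_fintype]; exact ρ.sum_eq_one (Set.mem_univ g)
  have h1 : F g = ∑ p : t, (ρ p g : ℂ) • F g := by
    rw [← Finset.sum_smul, ← Complex.ofReal_sum, hs]; simp
  have h2 : (tensorMap (∑ p : t, (⟨fun g => (ρ p g : ℂ), by fun_prop⟩ : C(G, ℂ)) ⊗ₜ[ℂ] F p)) g
      = ∑ p : t, (ρ p g : ℂ) • F p := by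
    simp [map_sum, ContinuousMap.sum_apply, tensorMap]
  rw [h2, h1, dist_eq_norm, ← Finset.sum_sub_distrib]
  calc ‖∑ p : t, ((ρ p g : ℂ) • F g - (ρ p g : ℂ) • F p)‖
      ≤ ∑ p : t, ρ p g * (ε / 2) := by
        refine norm_sum_le_of_le _ fun p _ => ?_
        rw [← smul_sub, norm_smul, Complex.norm_real, Real.norm_of_nonneg (ρ.nonneg p g)]
        by_cases h0 : ρ p g = 0
        · simp [h0]
        · have : g ∈ F ⁻¹' Metric.ball (F p) (ε / 2) := hρ p (subset_tsupport _ h0)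
          refine mul_le_mul_of_nonneg_left ?_ (ρ.nonneg p g)
          rw [← dist_eq_norm]
          exact (Metric.mem_ball.1 this).le
    _ = ε / 2 := by rw [← Finset.sum_mul, hs, one_mul]

end Tensor

/-! ### Translations -/

section Translation

variable {G : Type*} (D : Type*) [Group G] [TopologicalSpace G] [IsTopologicalGroup G]
  [CStarAlgebra D]

/-- The action of `G` on `C(G, D)` by translations, `(δ_g F)(h) = F(g⁻¹ h)`. -/
def translation : G →* (C(G, D) ≃⋆ₐ[ℂ] C(G, D)) where
  toFun g :=
    { toFun := fun F => F.comp ⟨fun h => g⁻¹ * h, by fun_prop⟩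
      invFun := fun F => F.comp ⟨fun h => g * h, by fun_prop⟩
      left_inv := fun F => by ext h; simp
      right_inv := fun F => by ext h; simp
      map_mul' := fun _ _ => rfl
      map_add' := fun _ _ => rfl
      map_star' := fun _ => rfl
      map_smul' := fun _ _ => rfl }
  map_one' := by ext F h; simp
  map_mul' g g' := by ext F h; simp [mul_assoc]

@[simp] theorem translation_apply (g h : G) (F : C(G, D)) :
    translation D g F h = F (g⁻¹ * h) := rfl

/-- On elementary tensors the action is `τ_g ⊗ ι`, where `τ` is translation on `C(G)`. -/
theorem translation_tensor (g : G) (f : C(G, ℂ)) (d : D) :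
    translation D g (tensor f d) = tensor (translation ℂ g f) d := rfl

end Translation

end CStarDynamics

end

open scoped TensorProduct InnerProductSpace

noncomputable section

namespace CStarDynamics

/-! ### Separating families of functionals and tensor products -/

/-! Let `S` consist of the maps `F ↦ u F(g⁻¹ ·) u*` with `g ∈ G` and `u` unitary on `H`. For strong
transitivity, the functionals `F ↦ ⟪ω, F(h) ξ⟫` separate points, so products of two of them detect
nonzero tensors. A translation aligns the two evaluation points, which leaves `∑ aᵢ u bᵢ u* = 0` for
all `u`. Cancelling `u*` and using that unitaries span `B(H)` gives `∑ aᵢ T bᵢ = 0` for every `T`,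
and rank one `T` splits this into products of matrix coefficients (`sum_inner_mul_inner_eq_zero`).

For `B` take the functions that are constant modulo compacts. It contains all `f ⊗ K` with `K` of
rank one, so whatever fixes `B` fixes every `f ⊗ 1`. But `f ⊗ 1 ∈ B` with `f` nonconstant would make
the identity of `H` compact (`constantModCompacts_ne_fixedPoints`). -/

/-- If `Φ` is a family of functionals separating the points of `V`, then the functionals `φ ⊗ ψ`
with `φ, ψ ∈ Φ` separate the points of `V ⊗ V`. -/
theorem sum_tmul_eq_zero_of_separating {k V : Type*} [Field k] [AddCommGroup V] [Module k V]
    (Φ : Set (V →ₗ[k] k)) (hΦ : ∀ a, (∀ φ ∈ Φ, φ a = 0) → a = 0) {n : ℕ} (x y : Fin n → V)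
    (h : ∀ φ ∈ Φ, ∀ ψ ∈ Φ, ∑ i, φ (x i) * ψ (y i) = 0) :
    (∑ i, x i ⊗ₜ[k] y i : V ⊗[k] V) = 0 := by
  classical
  let b := Module.Basis.ofVectorSpace k V
  let e := TensorProduct.equivFinsuppOfBasisRight (M := V) b
  refine e.map_eq_zero_iff.1 (Finsupp.ext fun j => hΦ _ fun φ hφ => ?_)
  -- Apply `φ` to the left factor only. The `j`-th coordinate of the result is `φ` of the
  -- coefficient of `b j` in the tensor.
  have hy : ∑ i, φ (x i) • y i = 0 := hΦ _ fun ψ hψ => by simpa using h φ hφ ψ hψ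
  have hj : b.repr (∑ i, φ (x i) • y i) j = 0 := by rw [hy]; simp
  simpa [e, Finsupp.finsetSum_apply, TensorProduct.equivFinsuppOfBasisRight_apply_tmul_apply,
    mul_comm] using hj

/-! ### Transitivity -/

/-- A single nonzero tensor `x ⊗ y` with `x ∈ C₁`, `y ∈ C₂` suffices, since invariance keeps `s y`
in `C₂`. Heredity plays no role. -/
theorem IsStronglyTopologicallyTransitive.isTopologicallyTransitive {A : Type*}
    [NonUnitalCStarAlgebra A] {S : Subgroup (A ≃⋆ₐ[ℂ] A)}
    (hS : IsStronglyTopologicallyTransitive S) : IsTopologicallyTransitive S := by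
  intro C₁ C₂ _ _ h₁ _ hC₂ h₂
  obtain ⟨x, hx, hx0⟩ := C₁.toNonUnitalSubalgebra.toSubmodule.exists_mem_ne_zero_of_ne_bot
    fun h => h₁ (SetLike.ext fun a => by
      simpa [NonUnitalStarAlgebra.mem_bot] using SetLike.ext_iff.1 h a)
  obtain ⟨y, hy, hy0⟩ := C₂.toNonUnitalSubalgebra.toSubmodule.exists_mem_ne_zero_of_ne_bot
    fun h => h₂ (SetLike.ext fun a => by
      simpa [NonUnitalStarAlgebra.mem_bot] using SetLike.ext_iff.1 h a)
  obtain ⟨s, hs, h⟩ := hS 1 (fun _ => x) (fun _ => y) (by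
    rw [Fin.sum_univ_one]
    intro h0
    obtain ⟨φ, hφ⟩ := not_forall.1 (mt (Module.forall_dual_apply_eq_zero_iff ℂ x).1 hx0)
    obtain ⟨ψ, hψ⟩ := not_forall.1 (mt (Module.forall_dual_apply_eq_zero_iff ℂ y).1 hy0)
    have := congrArg (LinearMap.mul' ℂ ℂ ∘ₗ TensorProduct.map φ ψ) h0
    exact mul_ne_zero hφ hψ (by simpa using this))
  refine ⟨x, hx, s y, ?_, by simpa using h⟩
  have : s y ∈ s '' (C₂ : Set A) := ⟨y, hy, rfl⟩
  rwa [hC₂ s hs] at this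

/-- A set mapped into itself by every element of a group of automorphisms is globally invariant. -/
theorem isInvariant_of_mapsTo {A : Type*} [NonUnitalCStarAlgebra A] {S : Subgroup (A ≃⋆ₐ[ℂ] A)}
    {B : Set A} (h : ∀ s ∈ S, Set.MapsTo s B B) : IsInvariant S B := by
  intro s hs
  refine (h s hs).image_subset.antisymm fun b hb => ⟨s⁻¹ b, h _ (S.inv_mem hs) hb, ?_⟩
  rw [← StarAlgEquiv.mul_apply, mul_inv_cancel, StarAlgEquiv.one_apply]

/-! ### Automorphisms of `C(G, D)` -/

section Functions

variable (G : Type*) [TopologicalSpace G] {D : Type*} [CStarAlgebra D]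

/-- Automorphisms of `D` act pointwise on `C(G, D)`. -/
def pointwiseAut : (D ≃⋆ₐ[ℂ] D) →* (C(G, D) ≃⋆ₐ[ℂ] C(G, D)) where
  toFun α :=
    { toFun := fun F => ⟨fun g => α (F g),
        (NonUnitalStarAlgHom.isometry α α.injective).continuous.comp F.continuous⟩
      invFun := fun F => ⟨fun g => α.symm (F g),
        (NonUnitalStarAlgHom.isometry α.symm α.symm.injective).continuous.comp F.continuous⟩
      left_inv := fun F => by ext g; simp
      right_inv := fun F => by ext g; simp
      map_mul' := fun _ _ => by ext g; simp
      map_add' := fun _ _ => by ext g; simp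
      map_star' := fun _ => by ext g; simp [map_star]
      map_smul' := fun _ _ => by ext g; simp }
  map_one' := rfl
  map_mul' _ _ := rfl

variable {G}

@[simp] theorem pointwiseAut_apply (α : D ≃⋆ₐ[ℂ] D) (F : C(G, D)) (g : G) :
    pointwiseAut G α F g = α (F g) := rfl

variable [Group G] [IsTopologicalGroup G]

theorem commute_translation_pointwiseAut (g : G) (α : D ≃⋆ₐ[ℂ] D) :
    Commute (translation D g) (pointwiseAut G α) := rfl

/-- Currying the jointly continuous map `(g, h) ↦ F (g⁻¹ * h)` gives continuity into the
compact-open topology, which is the norm topology as `G` is compact. -/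
theorem continuous_translation_apply [CompactSpace G] (F : C(G, D)) :
    Continuous fun g => translation D g F :=
  (ContinuousMap.curry ⟨fun p : G × G => F (p.1⁻¹ * p.2), by fun_prop⟩).continuous

theorem coe_fixedPoints_translation_top [CompactSpace G] :
    (fixedPoints (translation D) (⊤ : Subgroup G) : Set C(G, D)) =
      Set.range fun d : D => tensor 1 d := by
  ext F
  constructor
  · intro hF
    refine ⟨F 1, ?_⟩
    ext g
    -- Evaluating `δ_g F = F` at `g` itself gives `F 1 = F g`.
    have := congrArg (fun F' : C(G, D) => F' g) (hF g trivial)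
    simpa using this
  · rintro ⟨d, rfl⟩ g _
    ext h
    simp

end Functions

/-! ### The unitized compact operators -/

section Compacts

variable {H : Type*} [NormedAddCommGroup H] [InnerProductSpace ℂ H] [CompleteSpace H]

theorem IsCompactOperator.mem_unitizedCompacts {T : H →L[ℂ] H} (hT : IsCompactOperator T) :
    T ∈ unitizedCompacts H :=
  StarSubalgebra.le_topologicalClosure _ (StarAlgebra.subset_adjoin ℂ _ hT)

omit [CompleteSpace H] in
theorem isCompactOperator_rankOne (x y : H) :
    IsCompactOperator (InnerProductSpace.rankOne ℂ x y : H →L[ℂ] H) := by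
  rw [InnerProductSpace.rankOne_def']
  exact (isCompactOperator_of_locallyCompactSpace_dom (innerSL ℂ y)).clm_comp
    (ContinuousLinearMap.toSpanSingleton ℂ x)

theorem conj_mem_unitizedCompacts (u : unitary (H →L[ℂ] H)) {T : H →L[ℂ] H}
    (hT : T ∈ unitizedCompacts H) :
    Unitary.conjStarAlgAut ℂ (H →L[ℂ] H) u T ∈ unitizedCompacts H := by
  let α : (H →L[ℂ] H) →⋆ₐ[ℂ] (H →L[ℂ] H) := (Unitary.conjStarAlgAut ℂ (H →L[ℂ] H) u : _)
  have hα : Continuous α := by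
    change Continuous fun T : H →L[ℂ] H => (u : H →L[ℂ] H) * T * star (u : H →L[ℂ] H)
    fun_prop
  -- The preimage under conjugation is a closed unital `*`-subalgebra containing the compacts,
  -- because they form an ideal.
  have hle : unitizedCompacts H ≤ (unitizedCompacts H).comap α := by
    refine StarSubalgebra.topologicalClosure_minimal (StarAlgebra.adjoin_le fun K hK => ?_)
      ((StarSubalgebra.isClosed_topologicalClosure _).preimage hα)
    refine IsCompactOperator.mem_unitizedCompacts ?_
    exact (IsCompactOperator.comp_clm hK (star (u : H →L[ℂ] H))).clm_comp (u : H →L[ℂ] H)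
  exact hle hT

/-- Unitary operators act on the unitized compact operators by conjugation. -/
def conjUnitizedCompacts :
    unitary (H →L[ℂ] H) →* (unitizedCompacts H ≃⋆ₐ[ℂ] unitizedCompacts H) where
  toFun u :=
    { toFun := fun T => ⟨_, conj_mem_unitizedCompacts u T.2⟩
      invFun := fun T => ⟨_, conj_mem_unitizedCompacts u⁻¹ T.2⟩
      left_inv := fun T => Subtype.ext <| by
        simp [← StarAlgEquiv.mul_apply, -Unitary.conjStarAlgAut_apply]
      right_inv := fun T => Subtype.ext <| by
        simp [← StarAlgEquiv.mul_apply, -Unitary.conjStarAlgAut_apply]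
      map_mul' := fun _ _ => Subtype.ext (map_mul _ _ _)
      map_add' := fun _ _ => Subtype.ext (map_add _ _ _)
      map_star' := fun _ => Subtype.ext (map_star _ _)
      map_smul' := fun _ _ => Subtype.ext (map_smul _ _ _) }
  map_one' := by ext1 T; exact Subtype.ext (by simp)
  map_mul' u v := by
    ext1 T
    exact Subtype.ext (Unitary.conjStarAlgAut_mul_apply (S := ℂ) u v (T : H →L[ℂ] H))

theorem coe_conjUnitizedCompacts (u : unitary (H →L[ℂ] H)) (T : unitizedCompacts H) :
    (conjUnitizedCompacts u T : H →L[ℂ] H) = u * T * star (u : H →L[ℂ] H) := rfl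

theorem coe_conjUnitizedCompacts_sub (u : unitary (H →L[ℂ] H)) (T T' : unitizedCompacts H) :
    (conjUnitizedCompacts u T : H →L[ℂ] H) - (conjUnitizedCompacts u T' : H →L[ℂ] H) =
      u * ((T : H →L[ℂ] H) - T') * star (u : H →L[ℂ] H) := by
  have hT := coe_conjUnitizedCompacts u T
  have hT' := coe_conjUnitizedCompacts u T'
  generalize (conjUnitizedCompacts u T : H →L[ℂ] H) = a at *
  generalize (conjUnitizedCompacts u T' : H →L[ℂ] H) = b at *
  simp only [hT, hT', mul_sub, sub_mul]

theorem isCompactOperator_conjUnitizedCompacts_sub (u : unitary (H →L[ℂ] H))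
    {T T' : unitizedCompacts H} (h : IsCompactOperator (T - T' : H →L[ℂ] H) ∧
      IsCompactOperator ⇑(star (T - T' : H →L[ℂ] H))) :
    IsCompactOperator (conjUnitizedCompacts u T - conjUnitizedCompacts u T' : H →L[ℂ] H) ∧
      IsCompactOperator
        ⇑(star (conjUnitizedCompacts u T - conjUnitizedCompacts u T' : H →L[ℂ] H)) := by
  rw [coe_conjUnitizedCompacts_sub]
  refine ⟨(h.1.comp_clm _).clm_comp _, ?_⟩
  rw [star_mul, star_mul, star_star, ← mul_assoc]
  exact (h.2.clm_comp _).comp_clm _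

/-- If `∑ aᵢ u bᵢ u* = 0` for all unitaries `u`, then `∑ ⟪ω, aᵢ ξ⟫ ⟪η, bᵢ ζ⟫ = 0`. -/
theorem sum_inner_mul_inner_eq_zero {n : ℕ} (a b : Fin n → H →L[ℂ] H)
    (h : ∀ u : unitary (H →L[ℂ] H),
      ∑ i, a i * (u * b i * star (u : H →L[ℂ] H)) = 0) (ω ξ η ζ : H) :
    ∑ i, ⟪ω, a i ξ⟫_ℂ * ⟪η, b i ζ⟫_ℂ = 0 := by
  have key : ∀ T : H →L[ℂ] H, ∑ i, a i * T * b i = 0 := by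
    intro T
    -- The identity is linear in `T`, so it need only be checked on unitaries, where it is `h`
    -- multiplied on the right by `u`.
    have hT : T ∈ Submodule.span ℂ (unitary (H →L[ℂ] H) : Set (H →L[ℂ] H)) := by
      rw [CStarAlgebra.span_unitary]; trivial
    induction hT using Submodule.span_induction with
    | mem u hu =>
      have := congrArg (· * u) (h ⟨u, hu⟩)
      simpa [Finset.sum_mul, mul_assoc, Unitary.star_mul_self_of_mem hu] using this
    | zero => simp
    | add T T' _ _ hT hT' => simp [mul_add, add_mul, Finset.sum_add_distrib, hT, hT']
    | smul c T _ hT => simp [← Finset.smul_sum, hT]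
  -- For `T = ⟪η, ·⟫ ξ` one has `aᵢ T bᵢ ζ = ⟪η, bᵢ ζ⟫ aᵢ ξ`.
  have := congrArg (fun T : H →L[ℂ] H => ⟪ω, T ζ⟫_ℂ) (key (InnerProductSpace.rankOne ℂ ξ η))
  simpa [sum_apply, inner_sum, inner_smul_right, mul_comm] using this

end Compacts

/-! ### The dynamical system -/

section System

variable (G H : Type*) [NormedAddCommGroup H] [InnerProductSpace ℂ H] [CompleteSpace H]

/-- The functions in `C(G, unitizedCompacts H)` which are constant modulo the compact operators. -/
def constantModCompacts [TopologicalSpace G] :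
    NonUnitalStarSubalgebra ℂ C(G, unitizedCompacts H) where
  -- Requiring the adjoint to be compact as well makes closure under `star` immediate, without
  -- Schauder's theorem.
  carrier := {F | ∀ g h, IsCompactOperator (F g - F h : H →L[ℂ] H) ∧
    IsCompactOperator ⇑(star (F g - F h : H →L[ℂ] H))}
  zero_mem' g h := by simpa using isCompactOperator_zero
  add_mem' {F F'} hF hF' g h := by
    have e : ((F + F') g - (F + F') h : H →L[ℂ] H) = (F g - F h) + (F' g - F' h) := by
      simp; abel
    rw [e, star_add]
    exact ⟨(hF g h).1.add (hF' g h).1, (hF g h).2.add (hF' g h).2⟩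
  mul_mem' {F F'} hF hF' g h := by
    have e : ((F * F') g - (F * F') h : H →L[ℂ] H) =
        (F g - F h) * F' g + F h * (F' g - F' h) := by
      simp [sub_mul, mul_sub]
    rw [e, star_add, star_mul, star_mul]
    exact ⟨((hF g h).1.comp_clm _).add ((hF' g h).1.clm_comp _),
      ((hF g h).2.clm_comp (star (F' g : H →L[ℂ] H))).add
        ((hF' g h).2.comp_clm (star (F h : H →L[ℂ] H)))⟩
  smul_mem' c F hF g h := by
    have e : ((c • F) g - (c • F) h : H →L[ℂ] H) = c • (F g - F h) := by
      simp [smul_sub]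
    rw [e, star_smul]
    exact ⟨(hF g h).1.smul c, (hF g h).2.smul (star c)⟩
  star_mem' {F} hF g h := by
    have e : ((star F) g - (star F) h : H →L[ℂ] H) = star (F g - F h : H →L[ℂ] H) := by
      simp
    rw [e, star_star]
    exact ⟨(hF g h).2, (hF g h).1⟩

variable {G H}

theorem isClosed_constantModCompacts [TopologicalSpace G] :
    IsClosed (constantModCompacts G H : Set C(G, unitizedCompacts H)) := by
  have hK : IsClosed {T : H →L[ℂ] H | IsCompactOperator T} :=
    isClosed_setOfPred_isCompactOperator
  have hc (g h : G) :
      Continuous fun F : C(G, unitizedCompacts H) => (F g - F h : H →L[ℂ] H) := by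
    fun_prop
  have : (constantModCompacts G H : Set C(G, unitizedCompacts H)) =
      ⋂ (g : G) (h : G), {F | IsCompactOperator (F g - F h : H →L[ℂ] H)} ∩
        {F | IsCompactOperator ⇑(star (F g - F h : H →L[ℂ] H))} := by
    ext F
    simp only [Set.mem_iInter]
    rfl
  rw [this]
  exact isClosed_iInter fun g => isClosed_iInter fun h =>
    (hK.preimage (hc g h)).inter (hK.preimage (hc g h).star)

theorem tensor_mem_constantModCompacts [TopologicalSpace G] (f : C(G, ℂ))
    {T : unitizedCompacts H} (hT : IsCompactOperator (T : H →L[ℂ] H))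
    (hT' : IsCompactOperator ⇑(star (T : H →L[ℂ] H))) :
    tensor f T ∈ constantModCompacts G H := by
  intro g h
  have e : (tensor f T g - tensor f T h : H →L[ℂ] H) = (f g - f h) • (T : H →L[ℂ] H) := by
    simp [sub_smul]
  rw [e, star_smul]
  exact ⟨hT.smul _, hT'.smul _⟩

theorem pointwiseAut_mem_constantModCompacts [TopologicalSpace G] (u : unitary (H →L[ℂ] H))
    {F : C(G, unitizedCompacts H)} (hF : F ∈ constantModCompacts G H) :
    pointwiseAut G (conjUnitizedCompacts u) F ∈ constantModCompacts G H :=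
  fun g h => isCompactOperator_conjUnitizedCompacts_sub u (hF g h)

section Group

variable [Group G] [TopologicalSpace G] [IsTopologicalGroup G]

theorem translation_mem_constantModCompacts (g : G) {F : C(G, unitizedCompacts H)}
    (hF : F ∈ constantModCompacts G H) :
    translation (unitizedCompacts H) g F ∈ constantModCompacts G H :=
  fun h k => hF (g⁻¹ * h) (g⁻¹ * k)

theorem fixedPoints_top_le_constantModCompacts [CompactSpace G] :
    fixedPoints (translation (unitizedCompacts H)) (⊤ : Subgroup G) ≤ constantModCompacts G H := by
  intro F hF g h
  rw [← SetLike.mem_coe, coe_fixedPoints_translation_top] at hF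
  obtain ⟨T, rfl⟩ := hF
  simpa using isCompactOperator_zero

theorem constantModCompacts_ne_fixedPoints [CompactSpace G] [T2Space G] [Nontrivial G]
    (hH : ¬ FiniteDimensional ℂ H) :
    constantModCompacts G H ≠ fixedPoints (translation (unitizedCompacts H))
      (fixingSubgroup (translation (unitizedCompacts H)) (constantModCompacts G H)) := by
  have : Nontrivial H := by
    by_contra h
    rw [not_nontrivial_iff_subsingleton] at h
    exact hH inferInstance
  obtain ⟨v, hv⟩ := exists_ne (0 : H)
  let K : unitizedCompacts H :=
    ⟨_, IsCompactOperator.mem_unitizedCompacts (isCompactOperator_rankOne v v)⟩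
  have hK0 : K ≠ 0 := fun h => hv (by
    simpa [K, hv] using congrArg (fun T : unitizedCompacts H => (T : H →L[ℂ] H) v) h)
  have hK (f : C(G, ℂ)) : tensor f K ∈ constantModCompacts G H := by
    refine tensor_mem_constantModCompacts f (isCompactOperator_rankOne v v) ?_
    rw [ContinuousLinearMap.star_eq_adjoint, InnerProductSpace.adjoint_rankOne]
    exact isCompactOperator_rankOne v v
  obtain ⟨p, q, hpq⟩ := exists_pair_ne G
  -- Urysohn's lemma supplies a nonconstant `f`.
  obtain ⟨φ, hp, hq, -⟩ := exists_continuous_zero_one_of_isClosed (isClosed_singleton (x := p))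
    (isClosed_singleton (x := q)) (by simpa using hpq)
  let f : C(G, ℂ) := ⟨fun g => φ g, by fun_prop⟩
  have hfp : f p = 0 := by simpa [f] using hp rfl
  have hfq : f q = 1 := by simpa [f] using hq rfl
  intro hB
  have hf : tensor f 1 ∈ constantModCompacts G H := by
    rw [hB]
    intro g hg
    have hfg (h : G) : f (g⁻¹ * h) = f h := by
      -- Since `g` fixes `f ⊗ K` and `K ≠ 0`, the scalar function `f` is itself `g`-invariant.
      have := congrArg (fun F : C(G, unitizedCompacts H) => F h) (hg _ (hK f))
      exact smul_left_injective ℂ hK0 (by simpa using this)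
    ext1 h
    simp [hfg]
  -- The difference of the values of `f ⊗ 1` at `q` and `p` is the identity operator.
  have := (hf q p).1
  refine hH (FiniteDimensional.of_isCompactOperator_id (𝕜 := ℂ) ?_)
  simpa [hfp, hfq] using this

variable (G H) in
/-- The automorphisms `F ↦ u F(g⁻¹ ·) u*` of `C(G, unitizedCompacts H)`. -/
def translationConj : G × unitary (H →L[ℂ] H) →*
    (C(G, unitizedCompacts H) ≃⋆ₐ[ℂ] C(G, unitizedCompacts H)) :=
  (translation (unitizedCompacts H)).noncommCoprod ((pointwiseAut G).comp conjUnitizedCompacts)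
    fun g u => commute_translation_pointwiseAut g (conjUnitizedCompacts u)

theorem translationConj_apply (g : G) (u : unitary (H →L[ℂ] H)) (F : C(G, unitizedCompacts H)) :
    translationConj G H (g, u) F =
      translation (unitizedCompacts H) g (pointwiseAut G (conjUnitizedCompacts u) F) := rfl

theorem isStronglyTopologicallyTransitive_translationConj [CompactSpace G] :
    IsStronglyTopologicallyTransitive (translationConj G H).range := by
  intro n x y
  contrapose!
  intro hs
  let coeff (h : G) (ω ξ : H) : C(G, unitizedCompacts H) →ₗ[ℂ] ℂ :=
    { toFun := fun F => ⟪ω, (F h : H →L[ℂ] H) ξ⟫_ℂ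
      map_add' := fun _ _ => by simp
      map_smul' := fun _ _ => by simp }
  refine sum_tmul_eq_zero_of_separating {φ | ∃ h ω ξ, φ = coeff h ω ξ} (fun F hF => ?_) x y ?_
  · ext h ξ
    exact ext_inner_left ℂ fun ω => by simpa [coeff] using hF _ ⟨h, ω, ξ, rfl⟩
  · rintro _ ⟨h, ω, ξ, rfl⟩ _ ⟨k, η, ζ, rfl⟩
    refine sum_inner_mul_inner_eq_zero (fun i => (x i h : H →L[ℂ] H)) (fun i => (y i k : H →L[ℂ] H)) (fun u => ?_) ω ξ η ζ
    -- Translation by `h * k⁻¹` turns evaluation of `y i` at `h` into evaluation at `k`.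
    have := congrArg (fun F : C(G, unitizedCompacts H) => (F h : H →L[ℂ] H))
      (hs _ ⟨(h * k⁻¹, u), rfl⟩)
    have e : (h * k⁻¹)⁻¹ * h = k := by group
    simpa only [ContinuousMap.sum_apply, ContinuousMap.mul_apply, translationConj_apply,
      translation_apply, pointwiseAut_apply, e, AddSubmonoidClass.coe_finsetSum, MulMemClass.coe_mul,
      coe_conjUnitizedCompacts, ContinuousMap.zero_apply, ZeroMemClass.coe_zero] using this

theorem isInvariant_translationConj_constantModCompacts [CompactSpace G] :
    IsInvariant (translationConj G H).range
      (constantModCompacts G H : Set C(G, unitizedCompacts H)) := by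
  refine isInvariant_of_mapsTo ?_
  rintro _ ⟨⟨g, u⟩, rfl⟩ F hF
  exact translation_mem_constantModCompacts g (pointwiseAut_mem_constantModCompacts u hF)

theorem isInvariant_translation_constantModCompacts [CompactSpace G] :
    IsInvariant (translation (G := G) (unitizedCompacts H)).range
      (constantModCompacts G H : Set C(G, unitizedCompacts H)) := by
  refine isInvariant_of_mapsTo ?_
  rintro _ ⟨g, rfl⟩ F hF
  exact translation_mem_constantModCompacts g hF

end Group

/-- Conjugations always commute with translations; commutativity of `G` makes translations commute
with each other, and is needed only here. -/
theorem range_translationConj_le_commutingAut [CommGroup G] [TopologicalSpace G]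
    [IsTopologicalGroup G] [CompactSpace G] :
    (translationConj G H).range ≤ commutingAut (translation (G := G) (unitizedCompacts H)) := by
  rintro _ ⟨⟨g, u⟩, rfl⟩
  refine Subgroup.mem_centralizer_iff.2 ?_
  rintro _ ⟨k, rfl⟩
  ext1 F
  ext1 h
  simp [StarAlgEquiv.mul_apply, translationConj_apply, mul_left_comm]

end System

end CStarDynamics

end

open CStarDynamics in
theorem mainTheorem5
    {G : Type*} [CommGroup G] [TopologicalSpace G] [IsTopologicalGroup G]
    [CompactSpace G] [T2Space G] [Nontrivial G]
    {H : Type*} [NormedAddCommGroup H] [InnerProductSpace ℂ H] [CompleteSpace H]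
    (hH : ¬ FiniteDimensional ℂ H)
    (δ : G →* (C(G, unitizedCompacts H) ≃⋆ₐ[ℂ] C(G, unitizedCompacts H)))
    (hδ : δ = translation (unitizedCompacts H)) :
    (∀ a, Continuous fun g => δ g a) ∧
    (fixedPoints δ ⊤ : Set C(G, unitizedCompacts H)) =
      Set.range (fun T : unitizedCompacts H => tensor 1 T) ∧
    ∃ S : Subgroup (C(G, unitizedCompacts H) ≃⋆ₐ[ℂ] C(G, unitizedCompacts H)),
      S ≤ commutingAut δ ∧
      IsStronglyTopologicallyTransitive S ∧
      IsTopologicallyTransitive S ∧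
      ∃ B : NonUnitalStarSubalgebra ℂ C(G, unitizedCompacts H),
        IsClosed (B : Set C(G, unitizedCompacts H)) ∧
        IsInvariant δ.range (B : Set C(G, unitizedCompacts H)) ∧
        IsInvariant S (B : Set C(G, unitizedCompacts H)) ∧
        fixedPoints δ ⊤ ≤ B ∧
        B ≠ fixedPoints δ (fixingSubgroup δ B) := by
  subst hδ
  exact ⟨continuous_translation_apply, coe_fixedPoints_translation_top,
    (translationConj G H).range, range_translationConj_le_commutingAut,
    isStronglyTopologicallyTransitive_translationConj,
    IsStronglyTopologicallyTransitive.isTopologicallyTransitive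
      isStronglyTopologicallyTransitive_translationConj,
    constantModCompacts G H, isClosed_constantModCompacts,
    isInvariant_translation_constantModCompacts,
    isInvariant_translationConj_constantModCompacts,
    fixedPoints_top_le_constantModCompacts, constantModCompacts_ne_fixedPoints hH⟩
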